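/- Let $C^Q=\tfrac12(\mathbb 1-S)$ on $\mathbb C^2\otimes\mathbb C^2$, where $S(|x\rangle|y\rangle)=|y\rangle|x\rangle$. For qubit density matrices $\rho^A,\rho^B$ let $$T^Q(\rho^A,\rho^B)=\min_{\rho^{AB}}\operatorname{Tr}(C^Q\rho^{AB}),$$ where the minimum is over all density matrices $\rho^{AB}$ on $\mathbb C^2\otimes\mathbb C^2$ with partial traces $\operatorname{Tr}_B\rho^{AB}=\rho^A$ and $\operatorname{Tr}_A\rho^{AB}=\rho^B$. For $r\in[0,1]$ and $\theta\in\mathbb R$ let $$\rho(r,\theta)=\tfrac12\big[\mathbb 1+(2r-1)(\sigma_1\sin\theta+\sigma_3\cos\theta)\big],$$ where $\sigma_1,\sigma_3$ are Pauli matrices. Then for every $r\in(0,1)$ and every $v=(v_1,v_2)\in\mathbb R^2$ the limit below exists, the maximum below is attained, and $$\lim_{t\to0^+}\frac{T^Q\big(\rho(r,0),\rho(r+tv_1,tv_2)\big)}{t^2}=\max_{\phi\in[0,2\pi)}\frac{\big(2v_1\cos\phi-(2r-1)v_2\sin\phi\big)^2}{16\big(1+(2r-1)\cos\phi\big)}.$$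 -/

import Mathlib

open scoped ComplexOrder Topology

namespace QuantumTransport

section General

variable {n : Type*} [Fintype n]

/-- A density matrix: a positive semidefinite (hence Hermitian) matrix of trace one. -/
def IsDensity (ρ : Matrix n n ℂ) : Prop :=
  ρ.PosSemidef ∧ ρ.trace = 1

/-- Partial trace `Tr_A` over the first tensor factor. -/
def traceA (M : Matrix (n × n) (n × n) ℂ) : Matrix n n ℂ :=
  Matrix.of fun k l => ∑ i, M (i, k) (i, l)

/-- Partial trace `Tr_B` over the second tensor factor. -/
def traceB (M : Matrix (n × n) (n × n) ℂ) : Matrix n n ℂ :=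
  Matrix.of fun i j => ∑ k, M (i, k) (j, k)

/-- The coupling set `Γ^Q(ρA, ρB)`: bipartite states with marginals `ρA` and `ρB`. -/
def couplings (ρA ρB : Matrix n n ℂ) : Set (Matrix (n × n) (n × n) ℂ) :=
  {M | IsDensity M ∧ traceA M = ρB ∧ traceB M = ρA}

/-- The SWAP operator, `S (|x⟩|y⟩) = |y⟩|x⟩`. -/
def swapMatrix (n : Type*) [DecidableEq n] : Matrix (n × n) (n × n) ℂ :=
  Matrix.of fun p q => if p = q.swap then 1 else 0

/-- The quantum cost matrix `C^Q = (1 - S) / 2`, the projector onto the antisymmetric subspace. -/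
noncomputable def costMatrix (n : Type*) [DecidableEq n] : Matrix (n × n) (n × n) ℂ :=
  (1 / 2 : ℂ) • (1 - swapMatrix n)

/-- The optimal quantum transport cost `T^Q(ρA, ρB)`, the minimum of `Tr (C^Q M)` over all
couplings `M` (these traces are real). For density matrices the infimum is attained, see
`isLeast_transportCost`. -/
noncomputable def transportCost [DecidableEq n] (ρA ρB : Matrix n n ℂ) : ℝ :=
  sInf ((fun M => ((costMatrix n * M).trace).re) '' couplings ρA ρB)


theorem couplings_nonempty {ρA ρB : Matrix n n ℂ} (hA : IsDensity ρA) (hB : IsDensity ρB) :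
    (couplings ρA ρB).Nonempty := by
  have hA' : ∑ i, ρA i i = 1 := hA.2
  have hB' : ∑ i, ρB i i = 1 := hB.2
  refine ⟨Matrix.kronecker ρA ρB, ⟨hA.1.kronecker hB.1, ?_⟩, ?_, ?_⟩
  · have h := Matrix.trace_kronecker ρA ρB
    rw [hA.2, hB.2, mul_one] at h
    exact h
  · ext k l
    simp [traceA, ← Finset.sum_mul, hA']
  · ext k l
    simp [traceB, ← Finset.mul_sum, hB']

theorem isCompact_couplings (ρA ρB : Matrix n n ℂ) : IsCompact (couplings ρA ρB) := by
  have hK : IsCompact (Set.pi Set.univ fun _ : n × n => Set.pi Set.univ fun _ : n × n =>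
      Metric.closedBall (0 : ℂ) 1) :=
    isCompact_univ_pi fun _ => isCompact_univ_pi fun _ => isCompact_closedBall _ _
  refine hK.of_isClosed_subset ?_ ?_
  · have h1 : IsClosed {M : Matrix (n × n) (n × n) ℂ | M.PosSemidef} := by
      simp only [Matrix.posSemidef_iff_dotProduct_mulVec, Matrix.IsHermitian, Set.ofPred_and,
        Set.ofPred_forall]
      refine IsClosed.inter (isClosed_eq (by fun_prop) (by fun_prop))
        (isClosed_iInter fun x => isClosed_le (by fun_prop) ?_)
      fun_prop
    have h2 : IsClosed {M : Matrix (n × n) (n × n) ℂ | M.trace = 1} :=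
      isClosed_eq (by fun_prop) (by fun_prop)
    have h3 : IsClosed {M : Matrix (n × n) (n × n) ℂ | traceA M = ρB} := by
      refine isClosed_eq ?_ continuous_const
      unfold traceA
      exact continuous_matrix fun k l => by
        simp only [Matrix.of_apply]
        fun_prop
    have h4 : IsClosed {M : Matrix (n × n) (n × n) ℂ | traceB M = ρA} := by
      refine isClosed_eq ?_ continuous_const
      unfold traceB
      exact continuous_matrix fun k l => by
        simp only [Matrix.of_apply]
        fun_prop
    exact (h1.inter h2).inter (h3.inter h4)
  · rintro M ⟨⟨hM, htr⟩, -, -⟩ i - j -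
    have hd : ∀ k, 0 ≤ (M k k).re ∧ (M k k).im = 0 := fun k => by
      have := Complex.le_def.1 (hM.diag_nonneg (i := k))
      exact ⟨by simpa using this.1, by simpa using this.2.symm⟩
    have hle : ∀ k, (M k k).re ≤ 1 := fun k => by
      have h : ∑ k, (M k k).re = 1 := by
        have := congrArg Complex.re htr
        simp only [Matrix.trace, Complex.re_sum, Complex.one_re] at this
        exact this
      rw [← h]
      exact Finset.single_le_sum (f := fun k => (M k k).re) (fun k _ => (hd k).1)
        (Finset.mem_univ k)
    have hdet := (Complex.le_def.1 (hM.submatrix ![i, j]).det_nonneg).1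
    have hji : M j i = star (M i j) := (hM.1.apply j i).symm
    rw [Matrix.det_fin_two] at hdet
    change (0 : ℂ).re ≤ (M i i * M j j - M i j * M j i).re at hdet
    simp only [hji, Complex.sub_re, Complex.mul_re, Complex.zero_re,
      Complex.star_def, Complex.conj_re, Complex.conj_im, (hd i).2, (hd j).2] at hdet
    have hn : ‖M i j‖ ^ 2 ≤ 1 := by
      rw [Complex.sq_norm, Complex.normSq_apply]
      nlinarith [hle i, hle j, (hd i).1, (hd j).1]
    rw [mem_closedBall_zero_iff]
    nlinarith [norm_nonneg (M i j)]

theorem isLeast_transportCost [DecidableEq n] {ρA ρB : Matrix n n ℂ}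
    (hA : IsDensity ρA) (hB : IsDensity ρB) :
    IsLeast ((fun M => ((costMatrix n * M).trace).re) '' couplings ρA ρB)
      (transportCost ρA ρB) := by
  refine ((isCompact_couplings ρA ρB).image ?_).isLeast_sInf
    ((couplings_nonempty hA hB).image _)
  fun_prop

end General

/-- The Pauli matrix `σ₁`. -/
def pauli1 : Matrix (Fin 2) (Fin 2) ℂ := !![0, 1; 1, 0]

/-- The Pauli matrix `σ₃`. -/
def pauli3 : Matrix (Fin 2) (Fin 2) ℂ := !![1, 0; 0, -1]

/-- The states of the real slice of the Bloch ball,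
`ρ(r,θ) = (1 + (2r - 1) (σ₁ sin θ + σ₃ cos θ)) / 2`. -/
noncomputable def blochState (r θ : ℝ) : Matrix (Fin 2) (Fin 2) ℂ :=
  (1 / 2 : ℂ) • (1 + ((2 * r - 1 : ℝ) : ℂ) •
    (((Real.sin θ : ℝ) : ℂ) • pauli1 + ((Real.cos θ : ℝ) : ℂ) • pauli3))

theorem isDensity_blochState {r : ℝ} (hr : r ∈ Set.Icc (0 : ℝ) 1) (θ : ℝ) :
    IsDensity (blochState r θ) := by
  obtain ⟨x, rfl⟩ : ∃ x, θ = 2 * x := ⟨θ / 2, by ring⟩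
  have hsc : (Real.sin x : ℂ) ^ 2 + (Real.cos x : ℂ) ^ 2 = 1 := by
    exact_mod_cast Real.sin_sq_add_cos_sq x
  have h : blochState r (2 * x) =
      (r : ℂ) • Matrix.vecMulVec ![(Real.cos x : ℂ), (Real.sin x : ℂ)]
          (star ![(Real.cos x : ℂ), (Real.sin x : ℂ)]) +
        ((1 - r : ℝ) : ℂ) • Matrix.vecMulVec ![-(Real.sin x : ℂ), (Real.cos x : ℂ)]
          (star ![-(Real.sin x : ℂ), (Real.cos x : ℂ)]) := by
    ext i j
    simp only [Matrix.add_apply, Matrix.smul_apply, Matrix.vecMulVec_apply, Pi.star_apply]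
    fin_cases i <;> fin_cases j <;>
      simp [blochState, pauli1, pauli3, Real.sin_two_mul,
        Real.cos_two_mul, -Complex.ofReal_sin, -Complex.ofReal_cos] <;>
      first
        | linear_combination (r - 1 : ℂ) * hsc
        | linear_combination (-r : ℂ) * hsc
        | ring
  refine ⟨?_, ?_⟩
  · rw [h]
    exact ((Matrix.posSemidef_vecMulVec_self_star _).smul (by exact_mod_cast hr.1)).add
      ((Matrix.posSemidef_vecMulVec_self_star _).smul
        (by exact_mod_cast sub_nonneg.2 hr.2))
  · simp [blochState, pauli1, pauli3, Matrix.trace_fin_two]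

end QuantumTransport

namespace QuantumTransport

/-! The quadratic expansion of the cost follows from matching primal and dual bounds, with all data
in the real slice of the Bloch ball.

Lower bound (`dual_le_cost`): for the real pure state at Bloch angle `φ`, with populations `p`, `q`
in the two marginals, potentials depending on a parameter `s` bound the cost below by `(s - 1) (q -
s p) / (2 s)` for `s > 0`. Taking `s = 1 + t σ` with the best `σ` gives the quotient at angle `φ` to
order `t ^ 2`.

Upper bound (`exists_coupling_of_dual_bound`): if all these bounds hold with slack, a coupling of
the prescribed cost exists. A mixture of vectorised real matrices `α + x σ₃ + z σ₁ + c J` has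
marginals and cost fixed by the second moments of `(α, x, z, c)`, so only a positive moment matrix
is needed. The bounds say that a quadratic is nonnegative on the unit circle; a Lagrange multiplier
(`exists_multiplier_of_nonneg_on_circle`) turns this into a matrix inequality, which leaves room for
the `(x, z)` block. For costs `t ^ 2 * g` with `g` above the maximum, the hypothesis holds for small
`t`, uniformly in the angle. -/

/-- The real qubit state with Bloch coordinates `x` along `σ₃` and `z` along `σ₁`. -/
noncomputable def blochMatrix (x z : ℝ) : Matrix (Fin 2) (Fin 2) ℂ :=
  !![(((1 + x) / 2 : ℝ) : ℂ), ((z / 2 : ℝ) : ℂ); ((z / 2 : ℝ) : ℂ), (((1 - x) / 2 : ℝ) : ℂ)]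

theorem blochState_eq_blochMatrix (r θ : ℝ) :
    blochState r θ = blochMatrix ((2 * r - 1) * Real.cos θ) ((2 * r - 1) * Real.sin θ) := by
  ext i j
  fin_cases i <;> fin_cases j <;>
    simp [blochState, blochMatrix, pauli1, pauli3, -Complex.ofReal_sin, -Complex.ofReal_cos] <;>
    ring

theorem trace_costMatrix_mul (M : Matrix (Fin 2 × Fin 2) (Fin 2 × Fin 2) ℂ) :
    (costMatrix (Fin 2) * M).trace =
      (M (0, 1) (0, 1) + M (1, 0) (1, 0) - M (0, 1) (1, 0) - M (1, 0) (0, 1)) / 2 := by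
  simp [costMatrix, Matrix.trace, Matrix.mul_apply, Fintype.sum_prod_type, Fin.sum_univ_two,
    swapMatrix, Matrix.sub_apply, Matrix.one_apply]
  ring

/-! ### Couplings from second moments -/

/-- The vectorisation of the real matrix `α + x σ₃ + z σ₁ + c J`, where `J = i σ₂`. -/
def pauliVec (α x z c : ℝ) : Fin 2 × Fin 2 → ℝ := fun p =>
  (!![α + x, z + c; z - c, α - x] : Matrix (Fin 2) (Fin 2) ℝ) p.1 p.2

/-- The projector onto the vectorisation of a real matrix `X` has partial traces `X Xᵀ` and `Xᵀ X`,
and its antisymmetric part sees only `c`. The moments of `α c` and of the `(x, z)` block's shape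
stay free. The norm is `1 / 2` because the squared length of `pauliVec` is twice the sum of squares.
-/
theorem exists_coupling_of_moments {ι : Type*} [Fintype ι] (γ α x z c : ι → ℝ)
    (hγ : ∀ i, 0 ≤ γ i) (hnorm : ∑ i, γ i * (α i ^ 2 + x i ^ 2 + z i ^ 2 + c i ^ 2) = 1 / 2) :
    ∃ M ∈ couplings
        (blochMatrix (4 * ∑ i, γ i * (α i * x i) + 4 * ∑ i, γ i * (c i * z i))
          (4 * ∑ i, γ i * (α i * z i) - 4 * ∑ i, γ i * (c i * x i)))
        (blochMatrix (4 * ∑ i, γ i * (α i * x i) - 4 * ∑ i, γ i * (c i * z i))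
          (4 * ∑ i, γ i * (α i * z i) + 4 * ∑ i, γ i * (c i * x i))),
      ((costMatrix (Fin 2) * M).trace).re = 2 * ∑ i, γ i * c i ^ 2 := by
  let v : ι → Fin 2 × Fin 2 → ℝ := fun i => pauliVec (α i) (x i) (z i) (c i)
  let w : ι → Fin 2 × Fin 2 → ℂ := fun i p => (v i p : ℂ)
  have hentry : ∀ p q, (∑ i, (γ i : ℂ) • Matrix.vecMulVec (w i) (star (w i))) p q =
      ((∑ i, γ i * (v i p * v i q) : ℝ) : ℂ) := fun p q => by
    simp [Matrix.sum_apply, Matrix.vecMulVec_apply, w]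
  have hadd : ∀ b : ℝ, (1 + b) / 2 =
      ∑ i, γ i * (α i ^ 2 + x i ^ 2 + z i ^ 2 + c i ^ 2) + b / 2 := fun b => by
    rw [hnorm, add_div]
  have hsub : ∀ b : ℝ, (1 - b) / 2 =
      ∑ i, γ i * (α i ^ 2 + x i ^ 2 + z i ^ 2 + c i ^ 2) - b / 2 := fun b => by
    rw [hnorm, sub_div]
  refine ⟨∑ i, (γ i : ℂ) • Matrix.vecMulVec (w i) (star (w i)), ⟨⟨?_, ?_⟩, ?_, ?_⟩, ?_⟩
  · exact Matrix.posSemidef_sum _ fun i _ =>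
      (Matrix.posSemidef_vecMulVec_self_star _).smul (by exact_mod_cast hγ i)
  · simp only [Matrix.trace, Matrix.diag_apply, Fintype.sum_prod_type, Fin.sum_univ_two, hentry,
      ← Complex.ofReal_add]
    rw [Complex.ofReal_eq_one, show (1 : ℝ) = 2 * (1 / 2) by norm_num, ← hnorm, Finset.mul_sum]
    simp only [← Finset.sum_add_distrib]
    refine Finset.sum_congr rfl fun i _ => ?_
    simp [pauliVec, v]
    ring
  · ext k l
    fin_cases k <;> fin_cases l <;>
      simp only [traceA, Matrix.of_apply, Fin.sum_univ_two, hentry, ← Complex.ofReal_add] <;>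
      simp [blochMatrix, -Complex.ofReal_add, -Complex.ofReal_sub, -Complex.ofReal_div,
        -Complex.ofReal_sum, -Complex.ofReal_mul, -Complex.ofReal_one, Complex.ofReal_inj] <;>
      simp only [hadd, hsub, Finset.mul_sum, Finset.sum_div, ← Finset.sum_add_distrib,
        ← Finset.sum_sub_distrib] <;>
      refine Finset.sum_congr rfl fun i _ => ?_ <;>
      simp [pauliVec, v] <;> ring
  · ext k l
    fin_cases k <;> fin_cases l <;>
      simp only [traceB, Matrix.of_apply, Fin.sum_univ_two, hentry, ← Complex.ofReal_add] <;>
      simp [blochMatrix, -Complex.ofReal_add, -Complex.ofReal_sub, -Complex.ofReal_div,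
        -Complex.ofReal_sum, -Complex.ofReal_mul, -Complex.ofReal_one, Complex.ofReal_inj] <;>
      simp only [hadd, hsub, Finset.mul_sum, Finset.sum_div, ← Finset.sum_add_distrib,
        ← Finset.sum_sub_distrib] <;>
      refine Finset.sum_congr rfl fun i _ => ?_ <;>
      simp [pauliVec, v] <;> ring
  · rw [trace_costMatrix_mul]
    simp only [hentry, ← Complex.ofReal_add, ← Complex.ofReal_sub, ← Complex.ofReal_ofNat,
      ← Complex.ofReal_div, Complex.ofReal_re]
    simp only [← Finset.sum_add_distrib, ← Finset.sum_sub_distrib, Finset.sum_div,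
      Finset.mul_sum]
    refine Finset.sum_congr rfl fun i _ => ?_
    simp [pauliVec, v]
    ring

/-! ### Weak duality -/

/-- Weak duality for the potentials supported on the projector onto
`(cos (φ / 2), sin (φ / 2))`. -/
theorem dual_le_cost {a₁ a₂ b₁ b₂ : ℝ} {M : Matrix (Fin 2 × Fin 2) (Fin 2 × Fin 2) ℂ}
    (hM : M ∈ couplings (blochMatrix a₁ a₂) (blochMatrix b₁ b₂)) (φ s : ℝ) :
    s * (1 - s) * ((1 + a₁ * Real.cos φ + a₂ * Real.sin φ) / 2) +
      (s - 1) * ((1 + b₁ * Real.cos φ + b₂ * Real.sin φ) / 2) ≤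
      2 * s * ((costMatrix (Fin 2) * M).trace).re := by
  obtain ⟨y, rfl⟩ : ∃ y, φ = 2 * y := ⟨φ / 2, by ring⟩
  obtain ⟨⟨hpsd, -⟩, hB, hA⟩ := hM
  rw [trace_costMatrix_mul, Real.cos_two_mul, Real.sin_two_mul]
  have hsc := Real.sin_sq_add_cos_sq y
  generalize Real.cos y = c at *
  generalize Real.sin y = d at *
  have hA00 := congrArg Complex.re (congrFun₂ hA 0 0)
  have hA01 := congrArg Complex.re (congrFun₂ hA 0 1)
  have hA11 := congrArg Complex.re (congrFun₂ hA 1 1)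
  have hB00 := congrArg Complex.re (congrFun₂ hB 0 0)
  have hB01 := congrArg Complex.re (congrFun₂ hB 0 1)
  have hB11 := congrArg Complex.re (congrFun₂ hB 1 1)
  have hsymm : ∀ p q, (M p q).re = (M q p).re := fun p q => by
    rw [← hpsd.1.apply p q]; simp
  -- With `e = (c, d)` and `f = (-d, c)`, the dual slack operator is `|s ef - fe⟩⟨s ef - fe| + (s -
  -- 1)² |ee⟩⟨ee|`.
  have h1 := (Complex.le_def.1 (hpsd.dotProduct_mulVec_nonneg fun p =>
    ((s * (![c, d] p.1 * ![-d, c] p.2) - ![-d, c] p.1 * ![c, d] p.2 : ℝ) : ℂ))).1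
  have h2 := (Complex.le_def.1 (hpsd.dotProduct_mulVec_nonneg fun p =>
    ((![c, d] p.1 * ![c, d] p.2 : ℝ) : ℂ))).1
  have h3 := mul_nonneg (sq_nonneg (s - 1)) h2
  simp [blochMatrix, traceA, traceB, Fin.sum_univ_two] at hA00 hA01 hA11 hB00 hB01 hB11
  simp [dotProduct, Matrix.mulVec, Fintype.sum_prod_type, Fin.sum_univ_two] at h1 h3
  -- Factors `c ^ 2 + d ^ 2 = 1` make every term of degree four in `c`, `d`, so the final identity
  -- is purely polynomial.
  have hpop : ∀ x z : ℝ, (1 + x * (2 * c ^ 2 - 1) + z * (2 * d * c)) / 2 =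
      (c ^ 2 + d ^ 2) * (c ^ 2 * ((1 + x) / 2) + 2 * c * d * (z / 2) + d ^ 2 * ((1 - x) / 2)) :=
    fun x z => by
      have h : c ^ 2 + d ^ 2 = 1 := by rw [add_comm, hsc]
      rw [h]
      linear_combination (-(1 - x) / 2) * h
  rw [hpop, hpop, ← hA00, ← hA01, ← hA11, ← hB00, ← hB01, ← hB11]
  have hcost : ∀ x : ℝ, 2 * s * x = 2 * s * ((c ^ 2 + d ^ 2) ^ 2 * x) := fun x => by
    rw [add_comm, hsc]; ring
  rw [hcost]
  simp
  simp only [hsymm (0, 1) (0, 0), hsymm (1, 0) (0, 0), hsymm (1, 1) (0, 0), hsymm (1, 0) (0, 1),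
    hsymm (1, 1) (0, 1), hsymm (1, 1) (1, 0)] at h1 h3 ⊢
  linarith

/-! ### Strong duality -/

/-- Positive completion with `(x, z)` block `W`: regress `α` and `c` linearly on `(x, z)`, with
coefficients `(x₁, x₂)` and `(y₁, y₂)`. The hypotheses `hA`, `hK` make the residual variances
nonnegative; the residuals are taken uncorrelated. -/
theorem exists_coupling_of_completion {A K w₁ w₂ w₃ x₁ x₂ y₁ y₂ : ℝ} (hw : 0 < w₁)
    (hdet : 0 ≤ w₁ * w₃ - w₂ ^ 2)
    (hA : w₁ * x₁ ^ 2 + 2 * w₂ * x₁ * x₂ + w₃ * x₂ ^ 2 ≤ A)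
    (hK : w₁ * y₁ ^ 2 + 2 * w₂ * y₁ * y₂ + w₃ * y₂ ^ 2 ≤ K)
    (htr : A + (w₁ + w₃) + K = 1 / 2) :
    ∃ M ∈ couplings
        (blochMatrix (4 * (w₁ * x₁ + w₂ * x₂) + 4 * (w₂ * y₁ + w₃ * y₂))
          (4 * (w₂ * x₁ + w₃ * x₂) - 4 * (w₁ * y₁ + w₂ * y₂)))
        (blochMatrix (4 * (w₁ * x₁ + w₂ * x₂) - 4 * (w₂ * y₁ + w₃ * y₂))
          (4 * (w₂ * x₁ + w₃ * x₂) + 4 * (w₁ * y₁ + w₂ * y₂))),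
      ((costMatrix (Fin 2) * M).trace).re = 2 * K := by
  obtain ⟨l, rfl⟩ : ∃ l, w₂ = w₁ * l := ⟨w₂ / w₁, by field_simp⟩
  obtain ⟨g, rfl⟩ : ∃ g, w₃ = w₁ * l ^ 2 + g := ⟨w₃ - w₁ * l ^ 2, by ring⟩
  have hg : 0 ≤ g := by
    by_contra! h
    nlinarith [mul_pos hw (neg_pos.2 h)]
  -- The first two vectors come from the LDL factorisation of `W`, the last two carry the residuals.
  have key := exists_coupling_of_moments
    ![w₁, g, A - (w₁ * x₁ ^ 2 + 2 * (w₁ * l) * x₁ * x₂ + (w₁ * l ^ 2 + g) * x₂ ^ 2),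
      K - (w₁ * y₁ ^ 2 + 2 * (w₁ * l) * y₁ * y₂ + (w₁ * l ^ 2 + g) * y₂ ^ 2)]
    ![x₁ + l * x₂, x₂, 1, 0] ![1, 0, 0, 0] ![l, 1, 0, 0] ![y₁ + l * y₂, y₂, 0, 1]
    (by
      intro i
      fin_cases i
      · exact hw.le
      · exact hg
      · exact sub_nonneg.2 hA
      · exact sub_nonneg.2 hK)
    (by
      simp [Fin.sum_univ_four]
      linear_combination htr)
  simp only [Fin.sum_univ_four] at key
  obtain ⟨M, hM, hcost⟩ := key
  refine ⟨M, ?_, ?_⟩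
  · convert hM using 3 <;> simp <;> ring
  · rw [hcost]
    simp
    ring

/-- A quadratic polynomial that is nonnegative on the unit circle becomes, after adding a multiple
of `x ^ 2 + y ^ 2 - 1`, nonnegative on the plane (in homogenised form). -/
theorem exists_multiplier_of_nonneg_on_circle {c₀ c₁ c₂ n₁ n₂ n₃ : ℝ}
    (h : ∀ x y : ℝ, x ^ 2 + y ^ 2 = 1 →
      0 ≤ c₀ + 2 * (c₁ * x + c₂ * y) + n₁ * x ^ 2 + 2 * n₂ * x * y + n₃ * y ^ 2) :
    ∃ μ : ℝ, ∀ a x y : ℝ, 0 ≤ (c₀ - μ) * a ^ 2 + 2 * a * (c₁ * x + c₂ * y) +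
      (n₁ + μ) * x ^ 2 + 2 * n₂ * x * y + (n₃ + μ) * y ^ 2 := by
  let q : ℝ → ℝ → ℝ := fun x y =>
    c₀ + 2 * (c₁ * x + c₂ * y) + n₁ * x ^ 2 + 2 * n₂ * x * y + n₃ * y ^ 2
  have hcirc : IsCompact {z : ℂ | z.re ^ 2 + z.im ^ 2 = 1} := by
    refine (isCompact_sphere (0 : ℂ) 1).of_isClosed_subset
      (isClosed_eq (by fun_prop) (by fun_prop)) fun z hz => ?_
    have hz' : ‖z‖ ^ 2 = 1 := by
      rw [Complex.sq_norm, Complex.normSq_apply, ← sq, ← sq]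
      exact hz
    simpa using (pow_eq_one_iff_of_nonneg (norm_nonneg z) two_ne_zero).1 hz'
  obtain ⟨⟨C, S⟩, hCS, hmin⟩ := hcirc.exists_isMinOn ⟨1, by simp⟩
    (f := fun z => q z.re z.im) (by fun_prop)
  replace hCS : C ^ 2 + S ^ 2 = 1 := hCS
  have hq : ∀ x y : ℝ, x ^ 2 + y ^ 2 = 1 → q C S ≤ q x y := fun x y hxy =>
    hmin (show (⟨x, y⟩ : ℂ) ∈ {z : ℂ | z.re ^ 2 + z.im ^ 2 = 1} from hxy)
  -- The derivative along the rotation of the minimiser vanishes: the gradient is radial there,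
  -- which yields the multiplier `μ`.
  have hcrit : C * (n₂ * C + n₃ * S + c₂) - S * (n₁ * C + n₂ * S + c₁) = 0 := by
    let f : ℝ → ℝ := fun t => q (C * Real.cos t - S * Real.sin t) (S * Real.cos t + C * Real.sin t)
    have hloc : IsLocalMin f 0 := Filter.Eventually.of_forall fun t => by
      have := hq (C * Real.cos t - S * Real.sin t) (S * Real.cos t + C * Real.sin t)
        (by linear_combination (C ^ 2 + S ^ 2) * Real.sin_sq_add_cos_sq t + hCS)
      simpa [f] using this
    have hx : HasDerivAt (fun t => C * Real.cos t - S * Real.sin t) (-S) 0 := by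
      simpa using ((Real.hasDerivAt_cos 0).const_mul C).fun_sub
        ((Real.hasDerivAt_sin 0).const_mul S)
    have hy : HasDerivAt (fun t => S * Real.cos t + C * Real.sin t) C 0 := by
      simpa using ((Real.hasDerivAt_cos 0).const_mul S).fun_add
        ((Real.hasDerivAt_sin 0).const_mul C)
    have hf := ((((((hx.const_mul c₁).add (hy.const_mul c₂)).const_mul 2).const_add c₀).add
      ((hx.pow 2).const_mul n₁)).add ((hx.const_mul (2 * n₂)).mul hy)).add ((hy.pow 2).const_mul n₃)
    have := hloc.hasDerivAt_eq_zero hf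
    simp at this
    linear_combination this / 2
  let μ : ℝ := -(C * (n₁ * C + n₂ * S + c₁) + S * (n₂ * C + n₃ * S + c₂))
  have hc₁ : c₁ = -((n₁ + μ) * C + n₂ * S) := by
    simp only [μ]
    linear_combination (-(n₁ * C + n₂ * S + c₁)) * hCS - S * hcrit
  have hc₂ : c₂ = -(n₂ * C + (n₃ + μ) * S) := by
    simp only [μ]
    linear_combination (-(n₂ * C + n₃ * S + c₂)) * hCS + C * hcrit
  clear_value μ
  let P : ℝ → ℝ → ℝ := fun x y => (n₁ + μ) * x ^ 2 + 2 * n₂ * x * y + (n₃ + μ) * y ^ 2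
  -- The line through the minimiser in direction `(x, y)` meets the circle again at parameter `-k`,
  -- where the quadratic exceeds its minimum by `k ^ 2 * P x y`. Tangent directions need a limit.
  have hP' : ∀ x y : ℝ, C * x + S * y ≠ 0 → 0 ≤ P x y := fun x y hxy => by
    have hN : 0 < x ^ 2 + y ^ 2 := by
      by_contra! hN
      have hx : x = 0 := by nlinarith [sq_nonneg x, sq_nonneg y]
      have hy : y = 0 := by nlinarith [sq_nonneg x, sq_nonneg y]
      simp [hx, hy] at hxy
    obtain ⟨k, hk⟩ : ∃ k, k * (x ^ 2 + y ^ 2) = 2 * (C * x + S * y) :=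
      ⟨2 * (C * x + S * y) / (x ^ 2 + y ^ 2), by field_simp⟩
    have hk0 : k ≠ 0 := by
      rintro rfl
      exact hxy (by linarith)
    have hon : (C - k * x) ^ 2 + (S - k * y) ^ 2 = 1 := by linear_combination hCS + k * hk
    have hle := hq _ _ hon
    have : q (C - k * x) (S - k * y) - q C S = k ^ 2 * P x y := by
      simp only [q, P, hc₁, hc₂]
      linear_combination -μ * hon + μ * hCS
    nlinarith [sq_pos_of_ne_zero hk0]
  have hP : ∀ x y : ℝ, 0 ≤ P x y := fun x y => by
    by_cases hxy : C * x + S * y = 0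
    · have ht : Filter.Tendsto (fun e : ℝ => P (x + e * C) (y + e * S)) (𝓝[≠] 0) (𝓝 (P x y)) := by
        have : Continuous fun e : ℝ => P (x + e * C) (y + e * S) := by fun_prop
        simpa using (this.tendsto 0).mono_left nhdsWithin_le_nhds
      refine ge_of_tendsto ht ?_
      filter_upwards [self_mem_nhdsWithin] with e he
      refine hP' _ _ ?_
      have : C * (x + e * C) + S * (y + e * S) = e := by linear_combination hxy + e * hCS
      rw [this]
      exact he
    · exact hP' x y hxy
  refine ⟨μ, fun a x y => ?_⟩
  have h1 := mul_nonneg (h C S hCS) (sq_nonneg a)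
  have h2 := hP (x - a * C) (y - a * S)
  have : (c₀ - μ) * a ^ 2 + 2 * a * (c₁ * x + c₂ * y) +
      (n₁ + μ) * x ^ 2 + 2 * n₂ * x * y + (n₃ + μ) * y ^ 2 =
      q C S * a ^ 2 + P (x - a * C) (y - a * S) := by
    simp only [q, P, hc₁, hc₂]
    linear_combination (a ^ 2 * μ) * hCS
  rw [this]
  exact add_nonneg h1 h2

/-- Strong duality up to a slack `η`: if the dual bounds do not exceed `2 K`, there is a coupling
of cost `2 K`. -/
theorem exists_coupling_of_dual_bound {m₁ m₂ d₁ d₂ K η : ℝ} (hK : 0 < K) (hη : 0 < η)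
    (h : ∀ x y : ℝ, x ^ 2 + y ^ 2 = 1 →
      (d₁ * x + d₂ * y) ^ 2 ≤ 32 * K * (1 - 2 * K - η + m₁ * x + m₂ * y)) :
    ∃ M ∈ couplings (blochMatrix (m₁ - d₁ / 2) (m₂ - d₂ / 2))
        (blochMatrix (m₁ + d₁ / 2) (m₂ + d₂ / 2)),
      ((costMatrix (Fin 2) * M).trace).re = 2 * K := by
  obtain ⟨κ, hκ⟩ : ∃ κ : ℝ, κ * (32 * K) = 1 := ⟨1 / (32 * K), by field_simp⟩
  have hκ0 : 0 < κ := by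
    by_contra! hneg
    nlinarith
  obtain ⟨τ, hτ⟩ := exists_multiplier_of_nonneg_on_circle (c₀ := 1 - 2 * K - η) (c₁ := m₁ / 2)
    (c₂ := m₂ / 2) (n₁ := -κ * d₁ ^ 2) (n₂ := -κ * d₁ * d₂) (n₃ := -κ * d₂ ^ 2)
    (fun x y hxy => by
      have := mul_le_mul_of_nonneg_left (h x y hxy) hκ0.le
      rw [← mul_assoc, hκ] at this
      linarith)
  -- The slack pays for one `δ` in `A`, making it positive, and for `δ` times the identity in `W`,
  -- of trace `2 * δ`; the trace condition doubles this to `6 * δ`.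
  obtain ⟨δ, rfl⟩ : ∃ δ, η = 6 * δ := ⟨η / 6, by ring⟩
  obtain ⟨A, hAdef⟩ : ∃ A, A = (1 - 2 * K - 6 * δ - τ) / 2 + δ := ⟨_, rfl⟩
  have hδ : 0 < δ := by linarith
  have hA : 0 < A := by
    have := hτ 1 0 0
    simp at this
    linarith
  obtain ⟨ν, hν⟩ : ∃ ν : ℝ, ν * (8 * A) = 1 := ⟨1 / (8 * A), by field_simp⟩
  have hν0 : 0 < ν := by
    by_contra! hneg
    nlinarith
  -- Schur complement: the multiplier form is evaluated at the `a` that minimises it once the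
  -- constant coefficient is raised to `2 * A`.
  have hLU : ∀ x y : ℝ,
      ν * (m₁ * x + m₂ * y) ^ 2 ≤ τ * (x ^ 2 + y ^ 2) - κ * (d₁ * x + d₂ * y) ^ 2 := fun x y => by
    have h1 := hτ (-2 * ν * (m₁ * x + m₂ * y)) x y
    have h2 := mul_nonneg hδ.le (sq_nonneg (-2 * ν * (m₁ * x + m₂ * y)))
    have h3 : (1 - 2 * K - 6 * δ - τ) = 2 * A - 2 * δ := by linarith
    rw [h3] at h1
    have h4 : 2 * A * (-2 * ν * (m₁ * x + m₂ * y)) ^ 2 = ν * (m₁ * x + m₂ * y) ^ 2 := by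
      linear_combination (ν * (m₁ * x + m₂ * y) ^ 2) * hν
    linarith
  have hτd : κ * (d₁ ^ 2 + d₂ ^ 2) ≤ τ ∧ ν * (m₁ ^ 2 + m₂ ^ 2) ≤ τ := by
    have hτ0 : 0 ≤ τ := by
      have h1 := hLU 1 0
      have := mul_nonneg hν0.le (sq_nonneg (m₁ * 1 + m₂ * 0))
      have := mul_nonneg hκ0.le (sq_nonneg (d₁ * 1 + d₂ * 0))
      linarith
    constructor
    · rcases (add_nonneg (sq_nonneg d₁) (sq_nonneg d₂)).eq_or_lt with h0 | h0
      · rwa [← h0, mul_zero]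
      · have h1 := hLU d₁ d₂
        have := mul_nonneg hν0.le (sq_nonneg (m₁ * d₁ + m₂ * d₂))
        refine le_of_mul_le_mul_right ?_ h0
        linarith
    · rcases (add_nonneg (sq_nonneg m₁) (sq_nonneg m₂)).eq_or_lt with h0 | h0
      · rwa [← h0, mul_zero]
      · have h1 := hLU m₁ m₂
        have := mul_nonneg hκ0.le (sq_nonneg (d₁ * m₁ + d₂ * m₂))
        refine le_of_mul_le_mul_right ?_ h0
        linarith
  -- Up to `δ`, `2 W` must lie between `ν m mᵀ` and `τ - κ d dᵀ` and have trace `τ`. The traces of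
  -- these two bounds straddle `τ`, so a convex combination works.
  have hmem : τ ∈ segment ℝ (ν * (m₁ ^ 2 + m₂ ^ 2)) (2 * τ - κ * (d₁ ^ 2 + d₂ ^ 2)) := by
    rw [segment_eq_Icc (by linarith)]
    constructor <;> linarith
  obtain ⟨a, b, ha, hb, hab, htr⟩ := hmem
  simp only [smul_eq_mul] at htr
  obtain ⟨w₁, hw₁⟩ : ∃ w, w = (a * (ν * m₁ ^ 2) + b * (τ - κ * d₁ ^ 2)) / 2 + δ := ⟨_, rfl⟩
  obtain ⟨w₂, hw₂⟩ : ∃ w, w = (a * (ν * m₁ * m₂) + b * (-κ * d₁ * d₂)) / 2 := ⟨_, rfl⟩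
  obtain ⟨w₃, hw₃⟩ : ∃ w, w = (a * (ν * m₂ ^ 2) + b * (τ - κ * d₂ ^ 2)) / 2 + δ := ⟨_, rfl⟩
  have hW : ∀ x y : ℝ, 2 * (w₁ * x ^ 2 + 2 * w₂ * x * y + w₃ * y ^ 2) - 2 * δ * (x ^ 2 + y ^ 2) =
      a * (ν * (m₁ * x + m₂ * y) ^ 2) +
        b * (τ * (x ^ 2 + y ^ 2) - κ * (d₁ * x + d₂ * y) ^ 2) := fun x y => by
    rw [hw₁, hw₂, hw₃]
    ring
  have hlow : ∀ x y : ℝ, ν * (m₁ * x + m₂ * y) ^ 2 + 2 * δ * (x ^ 2 + y ^ 2) ≤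
      2 * (w₁ * x ^ 2 + 2 * w₂ * x * y + w₃ * y ^ 2) := fun x y => by
    have h1 := mul_le_mul_of_nonneg_left (hLU x y) hb
    have h2 := hW x y
    obtain rfl : a = 1 - b := by linarith
    linarith
  have hupp : ∀ x y : ℝ, 2 * (w₁ * x ^ 2 + 2 * w₂ * x * y + w₃ * y ^ 2) ≤
      τ * (x ^ 2 + y ^ 2) - κ * (d₁ * x + d₂ * y) ^ 2 + 2 * δ * (x ^ 2 + y ^ 2) := fun x y => by
    have h1 := mul_le_mul_of_nonneg_left (hLU x y) ha
    have h2 := hW x y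
    obtain rfl : b = 1 - a := by linarith
    linarith
  have htrW : w₁ + w₃ = τ / 2 + 2 * δ := by
    rw [hw₁, hw₃]
    linear_combination htr / 2
  have hw : 0 < w₁ := by
    have h1 := hlow 1 0
    have := mul_nonneg hν0.le (sq_nonneg (m₁ * 1 + m₂ * 0))
    linarith
  have hD : 0 < w₁ * w₃ - w₂ ^ 2 := by
    have h1 := hlow w₂ (-w₁)
    have := mul_nonneg hν0.le (sq_nonneg (m₁ * w₂ + m₂ * -w₁))
    have := mul_pos hδ (pow_pos hw 2)
    have := mul_nonneg hδ.le (sq_nonneg w₂)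
    refine pos_of_mul_pos_right (a := w₁) ?_ hw.le
    linarith
  obtain ⟨D, hD1⟩ : ∃ D, D * (w₁ * w₃ - w₂ ^ 2) = 1 := ⟨_, inv_mul_cancel₀ hD.ne'⟩
  have hsolve : ∀ u v : ℝ, ∃ x y, w₁ * x + w₂ * y = u ∧ w₂ * x + w₃ * y = v := fun u v =>
    ⟨D * (w₃ * u - w₂ * v), D * (w₁ * v - w₂ * u),
      by linear_combination u * hD1, by linear_combination v * hD1⟩
  obtain ⟨x₁, x₂, hx₁, hx₂⟩ := hsolve (m₁ / 4) (m₂ / 4)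
  -- The `c` moments involve `d` rotated by a right angle, so the bound on `K` concerns the adjugate
  -- `tr W - W` and hence uses the upper bound on `W`.
  obtain ⟨y₁, y₂, hy₁, hy₂⟩ := hsolve (d₂ / 8) (-d₁ / 8)
  have hsq : ∀ {q B : ℝ}, 0 < B → q ^ 2 ≤ B * q → q ≤ B := fun {q B} hB hqB => by
    by_contra! hlt
    nlinarith
  have key := exists_coupling_of_completion (A := A) (K := K) hw hD.le (x₁ := x₁) (x₂ := x₂)
    (y₁ := y₁) (y₂ := y₂)
    (by
      have h1 := hlow x₁ x₂
      obtain ⟨q, hq⟩ : ∃ q, q = w₁ * x₁ ^ 2 + 2 * w₂ * x₁ * x₂ + w₃ * x₂ ^ 2 := ⟨_, rfl⟩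
      rw [← hq] at h1 ⊢
      have h2 : m₁ * x₁ + m₂ * x₂ = 4 * q := by
        rw [hq]
        linear_combination (-4 * x₁) * hx₁ - 4 * x₂ * hx₂
      rw [h2] at h1
      have h3 := mul_nonneg hδ.le (add_nonneg (sq_nonneg x₁) (sq_nonneg x₂))
      have h4 := mul_le_mul_of_nonneg_left (show ν * (4 * q) ^ 2 ≤ 2 * q by linarith) hA.le
      refine hsq hA ?_
      linear_combination h4 / 2 - q ^ 2 * hν)
    (by
      have h1 := hupp y₂ (-y₁)
      obtain ⟨q, hq⟩ : ∃ q, q = w₁ * y₁ ^ 2 + 2 * w₂ * y₁ * y₂ + w₃ * y₂ ^ 2 := ⟨_, rfl⟩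
      rw [← hq]
      have h2 : d₁ * y₂ + d₂ * -y₁ = -8 * q := by
        rw [hq]
        linear_combination 8 * y₁ * hy₁ + 8 * y₂ * hy₂
      rw [h2] at h1
      have h3 := mul_nonneg hδ.le (add_nonneg (sq_nonneg y₁) (sq_nonneg y₂))
      have h5 : w₁ * y₂ ^ 2 + 2 * w₂ * y₂ * -y₁ + w₃ * (-y₁) ^ 2 =
          (τ / 2 + 2 * δ) * (y₁ ^ 2 + y₂ ^ 2) - q := by
        rw [hq, ← htrW]
        ring
      rw [h5] at h1
      have h4 := mul_le_mul_of_nonneg_left (show κ * (8 * q) ^ 2 ≤ 2 * q by linarith) hK.le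
      refine hsq hK ?_
      linear_combination h4 / 2 - q ^ 2 * hκ)
    (by rw [htrW, hAdef]; ring)
  rw [hx₁, hx₂, hy₁, hy₂] at key
  obtain ⟨M, hM, hcost⟩ := key
  refine ⟨M, ?_, hcost⟩
  convert hM using 3 <;> ring

/-! ### Small-time asymptotics -/

theorem exists_mem_Ico_forall_le_of_periodic {f : ℝ → ℝ} (hf : Continuous f) {p : ℝ}
    (hp : 0 < p) (hper : Function.Periodic f p) :
    ∃ x ∈ Set.Ico 0 p, ∀ y, f y ≤ f x := by
  obtain ⟨z, -, hz⟩ := isCompact_Icc.exists_isMaxOn (Set.nonempty_Icc.2 hp.le) hf.continuousOn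
  obtain ⟨x, hx, hzx⟩ := hper.exists_mem_Ico₀ hp z
  refine ⟨x, hx, fun y => ?_⟩
  obtain ⟨y', hy', hyy'⟩ := hper.exists_mem_Ico₀ hp y
  rw [hyy', ← hzx]
  exact hz (Set.Ico_subset_Icc_self hy')

theorem one_add_mul_cos_pos {s : ℝ} (hs : |s| < 1) (φ : ℝ) : 0 < 1 + s * Real.cos φ := by
  have h : |s * Real.cos φ| ≤ |s| := by
    rw [abs_mul]
    exact mul_le_of_le_one_right (abs_nonneg s) (Real.abs_cos_le_one φ)
  linarith [neg_abs_le (s * Real.cos φ)]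

theorem hasDerivAt_bloch_coordinates (r v₁ v₂ : ℝ) :
    HasDerivAt (fun t : ℝ => (2 * (r + t * v₁) - 1) * Real.cos (t * v₂)) (2 * v₁) 0 ∧
      HasDerivAt (fun t : ℝ => (2 * (r + t * v₁) - 1) * Real.sin (t * v₂))
        ((2 * r - 1) * v₂) 0 := by
  have h1 : HasDerivAt (fun t : ℝ => 2 * (r + t * v₁) - 1) (2 * v₁) 0 := by
    simpa using ((((hasDerivAt_id (0 : ℝ)).mul_const v₁).const_add r).const_mul 2).sub_const 1
  have h2 : HasDerivAt (fun t : ℝ => t * v₂) v₂ 0 := by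
    simpa using (hasDerivAt_id (0 : ℝ)).mul_const v₂
  exact ⟨by simpa using h1.fun_mul h2.cos, by simpa using h1.fun_mul h2.sin⟩

theorem eventually_mem_Icc_radius {r : ℝ} (hr : r ∈ Set.Ioo (0 : ℝ) 1) (v : ℝ) :
    ∀ᶠ t in 𝓝[>] (0 : ℝ), r + t * v ∈ Set.Icc (0 : ℝ) 1 := by
  have h : Filter.Tendsto (fun t : ℝ => r + t * v) (𝓝[>] 0) (𝓝 r) := by
    have : Continuous fun t : ℝ => r + t * v := by fun_prop
    simpa using (this.tendsto 0).mono_left nhdsWithin_le_nhds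
  exact (h.eventually (isOpen_Ioo.mem_nhds hr)).mono fun t ht => Set.Ioo_subset_Icc_self ht

theorem eventually_lt_transportCost_div_sq {r : ℝ} (hr : r ∈ Set.Ioo (0 : ℝ) 1) (v₁ v₂ φ a : ℝ)
    (ha : a < (2 * v₁ * Real.cos φ + (2 * r - 1) * v₂ * Real.sin φ) ^ 2 /
      (16 * (1 + (2 * r - 1) * Real.cos φ))) :
    ∀ᶠ t in 𝓝[>] (0 : ℝ),
      a < transportCost (blochState r 0) (blochState (r + t * v₁) (t * v₂)) / t ^ 2 := by
  have hpos : 0 < 1 + (2 * r - 1) * Real.cos φ :=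
    one_add_mul_cos_pos (abs_lt.2 ⟨by linarith [hr.1], by linarith [hr.2]⟩) φ
  let b : ℝ → ℝ := fun t => (1 + (2 * (r + t * v₁) - 1) * Real.cos (t * v₂) * Real.cos φ +
    (2 * (r + t * v₁) - 1) * Real.sin (t * v₂) * Real.sin φ) / 2
  let b' : ℝ := (2 * v₁ * Real.cos φ + (2 * r - 1) * v₂ * Real.sin φ) / 2
  -- Maximiser of the limiting dual bound `σ * (b' - σ * b 0) / 2`.
  let σ : ℝ := b' / (1 + (2 * r - 1) * Real.cos φ)
  have hb0 : b 0 = (1 + (2 * r - 1) * Real.cos φ) / 2 := by simp [b]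
  have hb : HasDerivAt b b' 0 :=
    ((((hasDerivAt_bloch_coordinates r v₁ v₂).1.mul_const _).const_add 1).fun_add
      ((hasDerivAt_bloch_coordinates r v₁ v₂).2.mul_const _)).div_const 2
  have hslope : Filter.Tendsto (fun t => t⁻¹ * (b t - b 0)) (𝓝[>] 0) (𝓝 b') := by
    simpa using hb.tendsto_slope_zero_right
  have hid : Filter.Tendsto (fun t : ℝ => t) (𝓝[>] 0) (𝓝 0) := nhdsWithin_le_nhds
  have hone : Filter.Tendsto (fun t : ℝ => 1 + t * σ) (𝓝[>] 0) (𝓝 1) := by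
    simpa using (hid.mul_const σ).const_add 1
  have hlim : Filter.Tendsto
      (fun t => σ * (t⁻¹ * (b t - b 0) - σ * b 0) / (2 * (1 + t * σ))) (𝓝[>] 0)
      (𝓝 ((2 * v₁ * Real.cos φ + (2 * r - 1) * v₂ * Real.sin φ) ^ 2 /
        (16 * (1 + (2 * r - 1) * Real.cos φ)))) := by
    have h := ((hslope.sub_const (σ * b 0)).const_mul σ).div (hone.const_mul 2) (by norm_num)
    have hval : σ * (b' - σ * b 0) / (2 * 1) =
        (2 * v₁ * Real.cos φ + (2 * r - 1) * v₂ * Real.sin φ) ^ 2 /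
          (16 * (1 + (2 * r - 1) * Real.cos φ)) := by
      rw [hb0]
      simp only [σ, b']
      generalize 1 + (2 * r - 1) * Real.cos φ = p at hpos
      field_simp
      ring
    rwa [hval] at h
  filter_upwards [hlim.eventually_const_lt ha, hone.eventually_const_lt one_pos,
    eventually_mem_Icc_radius hr v₁, self_mem_nhdsWithin] with t ht hs hrad ht0
  refine ht.trans_le ?_
  have ht0' : (0 : ℝ) < t := ht0
  obtain ⟨M, hM, hcost⟩ := (isLeast_transportCost
    (isDensity_blochState (Set.Ioo_subset_Icc_self hr) 0) (isDensity_blochState hrad (t * v₂))).1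
  rw [← hcost]
  rw [blochState_eq_blochMatrix, blochState_eq_blochMatrix] at hM
  have hdual := dual_le_cost hM φ (1 + t * σ)
  simp only [Real.cos_zero, Real.sin_zero, mul_one, mul_zero, zero_mul, add_zero] at hdual
  rw [div_le_div_iff₀ (by linarith) (by positivity)]
  rw [← hb0] at hdual
  change _ + _ * b t ≤ _ at hdual
  have : σ * (t⁻¹ * (b t - b 0) - σ * b 0) * t ^ 2 =
      σ * (t * (b t - b 0)) - t ^ 2 * (σ ^ 2 * b 0) := by
    field_simp
  rw [this]
  dsimp only
  linarith

theorem eventually_transportCost_div_sq_lt {r : ℝ} (hr : r ∈ Set.Ioo (0 : ℝ) 1) (v₁ v₂ G b : ℝ)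
    (hG : ∀ φ, (2 * v₁ * Real.cos φ + (2 * r - 1) * v₂ * Real.sin φ) ^ 2 /
      (16 * (1 + (2 * r - 1) * Real.cos φ)) ≤ G) (hb : G < b) :
    ∀ᶠ t in 𝓝[>] (0 : ℝ),
      transportCost (blochState r 0) (blochState (r + t * v₁) (t * v₂)) / t ^ 2 < b := by
  have hs : |2 * r - 1| < 1 := abs_lt.2 ⟨by linarith [hr.1], by linarith [hr.2]⟩
  obtain ⟨g, hGg, hgb⟩ := exists_between hb
  have hg : 0 < g := by
    refine lt_of_le_of_lt (le_trans ?_ (hG 0)) hGg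
    have := one_add_mul_cos_pos hs 0
    positivity
  let E₁ : ℝ → ℝ := fun t => t⁻¹ * ((2 * (r + t * v₁) - 1) * Real.cos (t * v₂) - (2 * r - 1))
  let E₂ : ℝ → ℝ := fun t => t⁻¹ * ((2 * (r + t * v₁) - 1) * Real.sin (t * v₂))
  have hid : Filter.Tendsto (fun t : ℝ => t) (𝓝[>] 0) (𝓝 0) := nhdsWithin_le_nhds
  have hE₁ : Filter.Tendsto E₁ (𝓝[>] 0) (𝓝 (2 * v₁)) := by
    simpa [E₁] using (hasDerivAt_bloch_coordinates r v₁ v₂).1.tendsto_slope_zero_right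
  have hE₂ : Filter.Tendsto E₂ (𝓝[>] 0) (𝓝 ((2 * r - 1) * v₂)) := by
    simpa [E₂] using (hasDerivAt_bloch_coordinates r v₁ v₂).2.tendsto_slope_zero_right
  -- A bound, independent of the angle, for the deviation of the rescaled dual inequality from its
  -- limit, `η` excepted.
  let err : ℝ → ℝ := fun t => |E₁ t ^ 2 - (2 * v₁) ^ 2| +
    2 * |E₁ t * E₂ t - 2 * v₁ * ((2 * r - 1) * v₂)| + |E₂ t ^ 2 - ((2 * r - 1) * v₂) ^ 2| +
    16 * g * (t ^ 2 * g + |t * E₁ t| / 2 + |t * E₂ t| / 2)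
  have herr : Filter.Tendsto err (𝓝[>] 0) (𝓝 0) := by
    have h := (((((hE₁.pow 2).sub_const ((2 * v₁) ^ 2)).abs).add
      ((((hE₁.mul hE₂).sub_const (2 * v₁ * ((2 * r - 1) * v₂))).abs).const_mul 2)).add
      (((hE₂.pow 2).sub_const (((2 * r - 1) * v₂) ^ 2)).abs)).add
      (((((hid.pow 2).mul_const g).add ((hid.mul hE₁).abs.div_const 2)).add
        ((hid.mul hE₂).abs.div_const 2)).const_mul (16 * g))
    simpa [err, abs_mul] using h
  -- At every angle the limiting inequality has at least this margin; half absorbs `err`, half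
  -- provides `η`.
  have hgap : 0 < 16 * (g - G) * (1 - |2 * r - 1|) :=
    mul_pos (by linarith) (by linarith)
  filter_upwards [herr.eventually_lt_const (half_pos hgap), eventually_mem_Icc_radius hr v₁,
    self_mem_nhdsWithin] with t ht hrad ht0
  have ht0' : (0 : ℝ) < t := ht0
  have hκ : 0 < t ^ 2 * g := by positivity
  obtain ⟨η, hη⟩ : ∃ η, 16 * g * η = 16 * (g - G) * (1 - |2 * r - 1|) / 2 :=
    ⟨16 * (g - G) * (1 - |2 * r - 1|) / 2 / (16 * g), by field_simp⟩
  have hη0 : 0 < η := by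
    refine pos_of_mul_pos_right (a := 16 * g) ?_ (by positivity)
    linarith
  -- Here `m` is the midpoint and `d` the difference of the two Bloch vectors, and the cost is `t ^
  -- 2 * g`.
  obtain ⟨M, hM, hcost⟩ := exists_coupling_of_dual_bound (m₁ := 2 * r - 1 + t * E₁ t / 2)
    (m₂ := t * E₂ t / 2) (d₁ := t * E₁ t) (d₂ := t * E₂ t) (half_pos hκ) hη0 (fun x y hxy => by
      obtain ⟨φ, rfl, rfl⟩ : ∃ φ, x = Real.cos φ ∧ y = Real.sin φ := by
        have hn : ‖(⟨x, y⟩ : ℂ)‖ = 1 := by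
          rw [← pow_eq_one_iff_of_nonneg (norm_nonneg _) two_ne_zero, Complex.sq_norm,
            Complex.normSq_mk, ← sq, ← sq, hxy]
        exact ⟨Complex.arg ⟨x, y⟩, by simpa [hn] using (Complex.norm_mul_cos_arg ⟨x, y⟩).symm,
          by simpa [hn] using (Complex.norm_mul_sin_arg ⟨x, y⟩).symm⟩
      have h1 := hG φ
      rw [div_le_iff₀ (mul_pos (by norm_num) (one_add_mul_cos_pos hs φ))] at h1
      have hc := Real.abs_cos_le_one φ
      have hsn := Real.abs_sin_le_one φ
      have hbd : ∀ u k : ℝ, |k| ≤ 1 → u * k ≤ |u| := fun u k hk =>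
        (le_abs_self _).trans (by
          rw [abs_mul]
          exact mul_le_of_le_one_right (abs_nonneg u) hk)
      have hcc : |Real.cos φ ^ 2| ≤ 1 := by
        rw [abs_pow]; exact pow_le_one₀ (abs_nonneg _) hc
      have hss : |Real.sin φ ^ 2| ≤ 1 := by
        rw [abs_pow]; exact pow_le_one₀ (abs_nonneg _) hsn
      have hcs : |Real.cos φ * Real.sin φ| ≤ 1 := by
        rw [abs_mul]; exact mul_le_one₀ hc (abs_nonneg _) hsn
      have e1 := hbd (E₁ t ^ 2 - (2 * v₁) ^ 2) _ hcc
      have e2 := hbd (E₁ t * E₂ t - 2 * v₁ * ((2 * r - 1) * v₂)) _ hcs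
      have e3 := hbd (E₂ t ^ 2 - ((2 * r - 1) * v₂) ^ 2) _ hss
      have e4 := mul_le_mul_of_nonneg_left (hbd (t * E₁ t) (-Real.cos φ) (by rwa [abs_neg])) hg.le
      have e5 := mul_le_mul_of_nonneg_left (hbd (t * E₂ t) (-Real.sin φ) (by rwa [abs_neg])) hg.le
      have e6 := mul_le_mul_of_nonneg_left (hbd (2 * r - 1) (-Real.cos φ) (by rwa [abs_neg]))
        (sub_nonneg.2 hGg.le)
      have hmain : (E₁ t * Real.cos φ + E₂ t * Real.sin φ) ^ 2 ≤ 16 * g *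
          (1 - t ^ 2 * g - η + (2 * r - 1 + t * E₁ t / 2) * Real.cos φ +
            t * E₂ t / 2 * Real.sin φ) := by
        simp only [err] at ht
        linarith
      have := mul_le_mul_of_nonneg_left hmain (sq_nonneg t)
      linarith)
  have hA : blochMatrix (2 * r - 1 + t * E₁ t / 2 - t * E₁ t / 2) (t * E₂ t / 2 - t * E₂ t / 2) =
      blochState r 0 := by
    rw [blochState_eq_blochMatrix]
    simp
  have hB : blochMatrix (2 * r - 1 + t * E₁ t / 2 + t * E₁ t / 2) (t * E₂ t / 2 + t * E₂ t / 2) =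
      blochState (r + t * v₁) (t * v₂) := by
    rw [blochState_eq_blochMatrix]
    simp only [E₁, E₂]
    congr 1 <;> field_simp <;> ring
  rw [hA, hB] at hM
  have hle := (isLeast_transportCost (isDensity_blochState (Set.Ioo_subset_Icc_self hr) 0)
    (isDensity_blochState hrad (t * v₂))).2 ⟨M, hM, hcost⟩
  rw [div_lt_iff₀ (by positivity)]
  have := mul_lt_mul_of_pos_left hgb (pow_pos ht0' 2)
  linarith

end QuantumTransport

theorem mainTheorem3 (r : ℝ) (hr : r ∈ Set.Ioo (0 : ℝ) 1) (v₁ v₂ : ℝ) :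
    ∃ G : ℝ,
      IsGreatest
        ((fun φ : ℝ =>
            (2 * v₁ * Real.cos φ - (2 * r - 1) * v₂ * Real.sin φ) ^ 2 /
              (16 * (1 + (2 * r - 1) * Real.cos φ))) '' Set.Ico 0 (2 * Real.pi)) G ∧
      Filter.Tendsto
        (fun t : ℝ =>
          QuantumTransport.transportCost (QuantumTransport.blochState r 0)
              (QuantumTransport.blochState (r + t * v₁) (t * v₂)) / t ^ 2)
        (𝓝[>] 0) (𝓝 G) := by
  have hs : |2 * r - 1| < 1 := abs_lt.2 ⟨by linarith [hr.1], by linarith [hr.2]⟩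
  obtain ⟨φ, hφ, hmax⟩ := QuantumTransport.exists_mem_Ico_forall_le_of_periodic
    (f := fun φ : ℝ => (2 * v₁ * Real.cos φ - (2 * r - 1) * v₂ * Real.sin φ) ^ 2 /
      (16 * (1 + (2 * r - 1) * Real.cos φ)))
    (Continuous.div (by fun_prop) (by fun_prop) fun φ =>
      (mul_pos (by norm_num) (QuantumTransport.one_add_mul_cos_pos hs φ)).ne')
    Real.two_pi_pos (fun φ => by simp)
  refine ⟨_, ⟨⟨φ, hφ, rfl⟩, ?_⟩, tendsto_order.2 ⟨fun a ha => ?_, fun b hb => ?_⟩⟩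
  · rintro _ ⟨ψ, -, rfl⟩
    exact hmax ψ
  -- The two sign conventions for the sine term differ by reflecting the angle.
  · refine QuantumTransport.eventually_lt_transportCost_div_sq hr v₁ v₂ (-φ) a ?_
    simpa [← sub_eq_add_neg] using ha
  · refine QuantumTransport.eventually_transportCost_div_sq_lt hr v₁ v₂ _ b (fun ψ => ?_) hb
    simpa [← sub_eq_add_neg] using hmax (-ψ)
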